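/- A GF(2)-grammar consists of an alphabet $\Sigma$, nonterminal symbols $N$, a finite set of rules $A \to X_1 \odot \dots \odot X_\ell$ ($\ell \ge 0$, $A \in N$, $X_i \in \Sigma \cup N$) and an initial symbol $S \in N$, such that in the ordinary context-free grammar with the rules $A \to X_1 \cdots X_\ell$ every string over $\Sigma$ has only finitely many parse trees. It describes the language of all strings that have an odd number of parse trees (with root $S$). Let $a \ne b$ be letters of an alphabet $\Sigma$. For $K \subseteq a^*b^* = \{a^n b^m : n, m \ge 0\}$, let $$\mathrm{Dual}(K) = \sum_{n, m \ge 0,\ a^n b^m \in K} a^n b^m \in \mathbb{F}_2[[a,b]],$$ a formal power series in two commuting variables. Let $\mathcal{A}$ be the set of all $f \in \mathbb{F}_2[[a]]$ that are algebraic, i.e. satisfy $P(f) = 0$ for some nonzero polynomial $P$ with coefficients in $\mathbb{F}_2[a]$, and let $\mathcal{B} \subseteq \mathbb{F}_2[[b]]$ be the analogous set for the variable $b$. Let $R_{a,b}$ be the set of all elements of the field of fractions of $\mathbb{F}_2[[a,b]]$ that can be written as $$\frac{\sum_{i=1}^n A_i B_i}{p}, \qquad n \ge 0,\ A_i \in \mathcal{A},\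 B_i \in \mathcal{B},\ p \in \mathbb{F}_2[a,b],\ p \ne 0.$$ **Theorem.** If a language $K \subseteq a^*b^*$ is described by a GF(2)-grammar over $\Sigma$, then $\mathrm{Dual}(K) \in R_{a,b}$. -/

import Mathlib

namespace GF2

/-- An ordered sequence of complete parse trees of the context-free grammar `G`, whose root labels
spell a given list of symbols. A tree is either a terminal leaf, or a node labelled by the left-hand
side of a rule, with a sequence of children whose root labels spell the right-hand side. -/
inductive ParseForest {T : Type*} (G : ContextFreeGrammar T) : List (Symbol T G.NT) → Type _
  | nil : ParseForest G []
  | terminal (t : T) {s : List (Symbol T G.NT)} (rest : ParseForest G s) :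
      ParseForest G (Symbol.terminal t :: s)
  | node (r : ContextFreeRule T G.NT) (hr : r ∈ G.rules) (children : ParseForest G r.output)
      {s : List (Symbol T G.NT)} (rest : ParseForest G s) :
      ParseForest G (Symbol.nonterminal r.input :: s)

/-- The string spelled by the leaves, from left to right. -/
def ParseForest.yield {T : Type*} {G : ContextFreeGrammar T} :
    {s : List (Symbol T G.NT)} → ParseForest G s → List T
  | _, .nil => []
  | _, .terminal t rest => t :: rest.yield
  | _, .node _ _ children rest => children.yield ++ rest.yield

/-- The parse trees with root label `A` of the string `w`. -/
def parseTrees {T : Type*} (G : ContextFreeGrammar T) (A : G.NT) (w : List T) :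
    Set (ParseForest G [Symbol.nonterminal A]) :=
  {t | t.yield = w}

/-- A GF(2)-grammar is given by its underlying ordinary grammar `G`; it is well-formed if every
string has finitely many parse trees (rooted at the initial symbol). -/
def WellFormed {T : Type*} (G : ContextFreeGrammar T) : Prop :=
  ∀ w : List T, (parseTrees G G.initial w).Finite

/-- The strings that have an odd number of parse trees with root label `A`. -/
def languageOf {T : Type*} (G : ContextFreeGrammar T) (A : G.NT) : Language T :=
  {w | Odd (parseTrees G A w).ncard}

/-- `K` is described by some (well-formed) GF(2)-grammar. -/
def IsDescribed {T : Type*} (K : Language T) : Prop :=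
  ∃ G : ContextFreeGrammar T, WellFormed G ∧ languageOf G G.initial = K

/-- The language `a^* b^*`. -/
def aStarBStar {T : Type*} (a b : T) : Language T :=
  {w | ∃ n m : ℕ, w = List.replicate n a ++ List.replicate m b}

/-- The power series `∑ a^n b^m` over all `(n, m)` such that the string `a^n b^m` is in `K`. In
`𝔽₂⟦a, b⟧`, the variable number `0` is `a` and the variable number `1` is `b`. -/
noncomputable def dual {T : Type*} (a b : T) (K : Language T) : MvPowerSeries (Fin 2) (ZMod 2) :=
  open scoped Classical in
  fun e => if List.replicate (e 0) a ++ List.replicate (e 1) b ∈ K then 1 else 0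

/-- The univariate series `f(t)`, read as a series in the variable number `i` of `𝔽₂⟦a, b⟧`. -/
noncomputable def inVar (i : Fin 2) (f : PowerSeries (ZMod 2)) : MvPowerSeries (Fin 2) (ZMod 2) :=
  MvPowerSeries.rename (fun _ : Unit => i) f

/-- The algebraic power series in the variable number `i`: those `f` with `P(f) = 0` for some
nonzero polynomial `P` with coefficients in the polynomial ring in that variable. For `i = 0` this
is the set `𝒜`, and for `i = 1` the set `ℬ`. -/
def algSeries (i : Fin 2) : Set (MvPowerSeries (Fin 2) (ZMod 2)) :=
  {g | ∃ f : PowerSeries (ZMod 2), IsAlgebraic (Polynomial (ZMod 2)) f ∧ g = inVar i f}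

/-- Laurent series: fractions of power series in `a` and `b`. -/
abbrev Laurent : Type := FractionRing (MvPowerSeries (Fin 2) (ZMod 2))

/-- The Laurent series of the form `(A₁ B₁ + ⋯ + Aₙ Bₙ) / p` with `n ≥ 0`, `Aᵢ ∈ 𝒜`, `Bᵢ ∈ ℬ` and
`p` a nonzero polynomial in `a` and `b`. -/
def Rab : Set Laurent :=
  {f | ∃ (n : ℕ) (A B : Fin n → MvPowerSeries (Fin 2) (ZMod 2)) (p : MvPolynomial (Fin 2) (ZMod 2)),
    (∀ i, A i ∈ algSeries 0) ∧ (∀ i, B i ∈ algSeries 1) ∧ p ≠ 0 ∧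
    f = algebraMap (MvPowerSeries (Fin 2) (ZMod 2)) Laurent (∑ i, A i * B i) /
        algebraMap (MvPowerSeries (Fin 2) (ZMod 2)) Laurent (p : MvPowerSeries (Fin 2) (ZMod 2))}

end GF2

/-!
The series of the words `a^n b^m` generated by the nonterminals of the grammar satisfy a linear
system. Indeed, in a word `a^n b^m` derived from `X₁ ⋯ Xₗ` at most one symbol contributes both
letters; the symbols before it derive powers of `a` and the symbols after it powers of `b`, so the
coefficients of the system are polynomials in the univariate series of the grammar for `a` and for
`b`. The univariate series are algebraic by the Jacobian criterion for separability.

The two determinants that have to be nonzero, that of the linear system and the Jacobian, have the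
same constant term `det (1 - M₀)`. A nonzero entry of `M₀` at `(A, B)` gives a derivation of
`x B y` from `A` where `x` and `y` derive `ε`. As every word has finitely many parse trees, such
derivations do not form cycles, so `M₀` is nilpotent. Cramer's rule then expresses the bivariate
series as a quotient of sums of products of algebraic series, and a multiple of the denominator is
a polynomial, since the denominator is itself algebraic.
-/

namespace GF2

/-! ### Linear algebra -/

section LinearAlgebra

variable {n R : Type*} [Fintype n] [DecidableEq n] [CommRing R]

theorem det_one_sub_ne_zero_of_wellFounded [IsDomain R] {M : Matrix n n R} {r : n → n → Prop}
    (hr : WellFounded r) (hM : ∀ i j, M i j ≠ 0 → r j i) : (1 - M).det ≠ 0 := by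
  rw [Ne, ← Matrix.exists_mulVec_eq_zero_iff]
  rintro ⟨v, hv, h⟩
  have hfix : v = M.mulVec v := by simpa [Matrix.sub_mulVec, sub_eq_zero] using h
  refine hv (funext fun i => hr.induction (C := fun i => v i = 0) i fun i ih => ?_)
  rw [hfix]
  refine Finset.sum_eq_zero fun j _ => ?_
  by_cases hij : M i j = 0
  · exact mul_eq_zero_of_left hij _
  · exact mul_eq_zero_of_right _ (ih j (hM i j hij))

theorem det_smul_eq_zero_of_sum_smul_eq_zero {V : Type*} [AddCommGroup V] [Module R V]
    {M : Matrix n n R} {v : n → V} (h : ∀ i, ∑ j, M i j • v j = 0) (i : n) : M.det • v i = 0 := by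
  open scoped Matrix.Module in
  have hMv : M • v = 0 := funext h
  have hdet : M.det • v = (M.adjugate * M) • v := by
    rw [Matrix.adjugate_mul, smul_assoc, one_smul]
  exact congrFun (hdet.trans (by rw [mul_smul, hMv, smul_zero])) i

variable {σ : Type*} [SetLike σ R] [SubringClass σ R] {C : σ}

theorem det_mem {M : Matrix n n R} (hM : ∀ i j, M i j ∈ C) : M.det ∈ C := by
  rw [Matrix.det_apply]
  exact sum_mem fun π _ => zsmul_mem (prod_mem fun i _ => hM _ _) _

theorem det_mul_mem_of_mulVec_mem {M : Matrix n n R} {v : n → R} (hM : ∀ i j, M i j ∈ C)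
    (hv : ∀ i, M.mulVec v i ∈ C) (i : n) : M.det * v i ∈ C := by
  have hcramer : M.cramer (M.mulVec v) = M.det • v := by
    rw [Matrix.cramer_eq_adjugate_mulVec, Matrix.mulVec_mulVec, Matrix.adjugate_mul,
      Matrix.smul_mulVec, Matrix.one_mulVec]
  rw [← smul_eq_mul, ← Pi.smul_apply, ← hcramer, Matrix.cramer_apply]
  refine det_mem fun j l => ?_
  rw [Matrix.updateCol_apply]
  split_ifs
  exacts [hv j, hM j l]

end LinearAlgebra

/-! ### Nondegenerate solutions of polynomial systems -/

section Jacobian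

open MvPolynomial

theorem derivation_aeval {R A M ι : Type*} [CommSemiring R] [CommSemiring A] [Algebra R A]
    [AddCommMonoid M] [Module A M] [Module R M] [IsScalarTower R A M] [Fintype ι]
    (D : Derivation R A M) (x : ι → A) (p : MvPolynomial ι R) :
    D (aeval x p) = ∑ j, aeval x (pderiv j p) • D (x j) := by
  classical
  induction p using MvPolynomial.induction_on with
  | C r => simp
  | add p q hp hq => simp [hp, hq, add_smul, Finset.sum_add_distrib]
  | mul_X p i hp =>
    simp [hp, pderiv_X, Pi.single_apply, apply_ite, ite_smul, add_smul, mul_smul,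
      Finset.sum_add_distrib, Finset.smul_sum]

theorem derivation_eq_zero_of_mem_adjoin {F K M : Type*} [Field F] [Field K] [Algebra F K]
    [AddCommGroup M] [Module K M] [Module F M] (D : Derivation F K M) {s : Set K}
    (hs : ∀ x ∈ s, D x = 0) {x : K} (hx : x ∈ IntermediateField.adjoin F s) : D x = 0 := by
  induction hx using IntermediateField.adjoin_induction with
  | mem x hx => exact hs x hx
  | algebraMap x => exact D.map_algebraMap x
  | add x y _ _ hx hy => rw [map_add, hx, hy, add_zero]
  | inv x _ hx => rw [D.leibniz_inv, hx, smul_zero]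
  | mul x y _ _ hx hy => rw [D.leibniz, hx, hy, smul_zero, smul_zero, add_zero]

variable {ι : Type*} [Fintype ι] [DecidableEq ι]

theorem isSeparable_of_det_pderiv_ne_zero {F K : Type*} [Field F] [Field K] [Algebra F K]
    {x : ι → K} (hx : IntermediateField.adjoin F (Set.range x) = ⊤) {P : ι → MvPolynomial ι F}
    (hP : ∀ i, aeval x (P i) = 0)
    (hJ : (Matrix.of fun i j => aeval x (pderiv j (P i))).det ≠ 0) : Algebra.IsSeparable F K := by
  have hgen : ∀ y ∈ Set.range x, KaehlerDifferential.D F K y = 0 := by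
    rintro _ ⟨j, rfl⟩
    refine (smul_eq_zero.1 (det_smul_eq_zero_of_sum_smul_eq_zero
      (v := fun j => KaehlerDifferential.D F K (x j)) (fun i => ?_) j)).resolve_left hJ
    simpa only [Matrix.of_apply, hP, map_zero] using
      (derivation_aeval (KaehlerDifferential.D F K) x (P i)).symm
  have hD (y : K) : KaehlerDifferential.D F K y = 0 :=
    derivation_eq_zero_of_mem_adjoin _ hgen (hx ▸ IntermediateField.mem_top)
  have hunr : Algebra.FormallyUnramified F K := by
    refine ⟨Submodule.subsingleton_iff K |>.1 (subsingleton_of_bot_eq_top ?_)⟩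
    rw [← KaehlerDifferential.span_range_derivation, eq_comm, Submodule.span_eq_bot]
    rintro _ ⟨y, rfl⟩
    exact hD y
  have : Algebra.EssFiniteType F K := by
    rw [← IntermediateField.fg_top_iff, ← hx]
    exact IntermediateField.fg_adjoin_of_finite (Set.finite_range x)
  exact (Algebra.FormallyUnramified.iff_isSeparable F K).1 hunr

theorem isAlgebraic_of_det_pderiv_ne_zero_of_field {F K : Type*} [Field F] [Field K] [Algebra F K]
    {x : ι → K} {P : ι → MvPolynomial ι F} (hP : ∀ i, aeval x (P i) = 0)
    (hJ : (Matrix.of fun i j => aeval x (pderiv j (P i))).det ≠ 0) (i : ι) :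
    IsAlgebraic F (x i) := by
  let E := IntermediateField.adjoin F (Set.range x)
  let y : ι → E := fun i => ⟨x i, IntermediateField.subset_adjoin F _ ⟨i, rfl⟩⟩
  have hxy (p : MvPolynomial ι F) : aeval x p = algebraMap E K (aeval y p) :=
    aeval_algebraMap_apply K y p
  have hgen : IntermediateField.adjoin F (Set.range y) = ⊤ := by
    apply IntermediateField.lift_injective E
    rw [IntermediateField.lift_adjoin, IntermediateField.lift_top, ← Set.range_comp]
    rfl
  have hsep : Algebra.IsSeparable F E := by
    refine isSeparable_of_det_pderiv_ne_zero hgen (P := P) (fun i => ?_) fun h => hJ ?_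
    · exact (algebraMap E K).injective (by rw [← hxy, hP, map_zero])
    · rw [← map_zero (algebraMap E K), ← h, RingHom.map_det]
      exact congrArg Matrix.det (Matrix.ext fun _ _ => hxy _)
  exact (hsep.isAlgebraic.isAlgebraic (y i)).algebraMap

theorem isAlgebraic_of_det_pderiv_ne_zero {R S : Type*} [CommRing R] [CommRing S] [IsDomain S]
    [Algebra R S] [FaithfulSMul R S] {x : ι → S} {P : ι → MvPolynomial ι R}
    (hP : ∀ i, aeval x (P i) = 0)
    (hJ : (Matrix.of fun i j => aeval x (pderiv j (P i))).det ≠ 0) (i : ι) :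
    IsAlgebraic R (x i) := by
  have : IsDomain R := (FaithfulSMul.algebraMap_injective R S).isDomain
  let F := FractionRing R
  let K := FractionRing S
  have : FaithfulSMul R K := .trans R S K
  let : Algebra F K := FractionRing.liftAlgebra R K
  have : IsScalarTower R F K := FractionRing.isScalarTower_liftAlgebra R K
  have hinj : Function.Injective (algebraMap S K) := IsFractionRing.injective S K
  have hmap (p : MvPolynomial ι R) :
      aeval (fun i => algebraMap S K (x i)) (p.map (algebraMap R F)) =
        algebraMap S K (aeval x p) := by
    rw [aeval_map_algebraMap]
    exact aeval_algebraMap_apply K x p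
  rw [← isAlgebraic_algebraMap_iff hinj (R := R), IsFractionRing.isAlgebraic_iff R F K]
  refine isAlgebraic_of_det_pderiv_ne_zero_of_field (x := fun i => algebraMap S K (x i))
    (P := fun i => (P i).map (algebraMap R F)) (fun i => by rw [hmap, hP, map_zero])
    (fun h => hJ (hinj ?_)) i
  rw [map_zero, ← h, RingHom.map_det]
  exact congrArg Matrix.det (Matrix.ext fun _ _ => by simp [pderiv_map, hmap])

end Jacobian

/-! ### Skew derivations of a free monoid -/

section SkewDerivation

variable {ι R : Type*} [CommSemiring R]

/-- The `(α, β)`-skew derivation `∂` of the free monoid on `ι`, i.e. the map satisfying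
`∂ (s ++ t) = ∂ s * β t + α s * ∂ t` for the multiplicative extensions of `α` and `β`, as a function
of its values on the letters: it sends `δ` to `∑ i, α (s₁ ⋯ sᵢ₋₁) * δ sᵢ * β (sᵢ₊₁ ⋯ sₙ)`. -/
def skewDeriv (α β : ι → R) : List ι → (ι → R) →ₗ[R] R
  | [] => 0
  | x :: s => (s.map β).prod • LinearMap.proj x + α x • skewDeriv α β s

@[simp]
theorem skewDeriv_nil (α β δ : ι → R) : skewDeriv α β [] δ = 0 :=
  rfl

@[simp]
theorem skewDeriv_cons (α β δ : ι → R) (x : ι) (s : List ι) :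
    skewDeriv α β (x :: s) δ = (s.map β).prod * δ x + α x * skewDeriv α β s δ :=
  rfl

theorem map_skewDeriv {R' : Type*} [CommSemiring R'] (φ : R →+* R') (α β δ : ι → R)
    (s : List ι) : φ (skewDeriv α β s δ) = skewDeriv (φ ∘ α) (φ ∘ β) s (φ ∘ δ) := by
  induction s with
  | nil => simp
  | cons x s ih => simp [ih, map_list_prod]

theorem skewDeriv_congr {α α' β β' δ δ' : ι → R} {s : List ι} (hα : ∀ x ∈ s, α x = α' x)
    (hβ : ∀ x ∈ s, β x = β' x) (hδ : ∀ x ∈ s, δ x = δ' x) :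
    skewDeriv α β s δ = skewDeriv α' β' s δ' := by
  induction s with
  | nil => rfl
  | cons x s ih =>
    rw [List.forall_mem_cons] at hα hβ hδ
    rw [skewDeriv_cons, skewDeriv_cons, ih hα.2 hβ.2 hδ.2, hα.1, hδ.1, List.map_congr_left hβ.2]

theorem skewDeriv_mem {S : Type*} [SetLike S R] [SubsemiringClass S R] {C : S} {α β δ : ι → R}
    {s : List ι} (hα : ∀ x ∈ s, α x ∈ C) (hβ : ∀ x ∈ s, β x ∈ C) (hδ : ∀ x ∈ s, δ x ∈ C) :
    skewDeriv α β s δ ∈ C := by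
  induction s with
  | nil => exact zero_mem C
  | cons x s ih =>
    rw [List.forall_mem_cons] at hα hβ hδ
    exact add_mem (mul_mem (list_prod_mem (by simpa using hβ.2)) hδ.1)
      (mul_mem hα.1 (ih hα.2 hβ.2 hδ.2))

theorem derivation_list_prod {k : Type*} [CommSemiring k] [Algebra k R] (D : Derivation k R R)
    (f : ι → R) (s : List ι) : D (s.map f).prod = skewDeriv f f s (D ∘ f) := by
  induction s with
  | nil => simp
  | cons x s ih => simp [ih, add_comm]

end SkewDerivation

/-! ### Parse forests -/

theorem card_append_eq {α P Q : Type*} (f : P → List α) (g : Q → List α)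
    (hf : ∀ w, Finite {p // f p = w}) (hg : ∀ w, Finite {q // g q = w}) (w : List α) :
    Nat.card {x : P × Q // f x.1 ++ g x.2 = w} = ∑ k ∈ Finset.range (w.length + 1),
      Nat.card {p // f p = w.take k} * Nat.card {q // g q = w.drop k} := by
  let cut (x : {x : P × Q // f x.1 ++ g x.2 = w}) : Fin (w.length + 1) :=
    ⟨(f x.1.1).length, by simp [← x.2]⟩
  have hcut (k : Fin (w.length + 1)) : {x // cut x = k} ≃
      {p // f p = w.take k} × {q // g q = w.drop k} :=
    (Equiv.subtypeSubtypeEquivSubtypeExists _ _).trans <|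
      (Equiv.subtypeEquivRight fun x => by
        constructor
        · rintro ⟨rfl, rfl⟩
          simp [cut]
        · rintro ⟨h₁, h₂⟩
          refine ⟨by rw [h₁, h₂, List.take_append_drop], Fin.ext ?_⟩
          simpa [cut, h₁] using Nat.le_of_lt_succ k.2).trans
      Equiv.subtypeProdEquivProd
  rw [Nat.card_congr ((Equiv.sigmaFiberEquiv cut).symm.trans (Equiv.sigmaCongrRight hcut)),
    Nat.card_sigma, Finset.sum_range]
  simp only [Nat.card_prod]

variable {T : Type*} {G : ContextFreeGrammar T}

namespace ParseForest

variable {X : Symbol T G.NT} {s : List (Symbol T G.NT)}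

/-- The number of terminals and internal nodes. -/
def size : {s : List (Symbol T G.NT)} → ParseForest G s → ℕ
  | _, .nil => 0
  | _, .terminal _ rest => rest.size + 1
  | _, .node _ _ children rest => children.size + rest.size + 1

/-- The forest with first tree `p` and remaining trees `q`. -/
def cons (p : ParseForest G [X]) (q : ParseForest G s) : ParseForest G (X :: s) :=
  match X, p with
  | _, .terminal t _ => .terminal t q
  | _, .node r hr children _ => .node r hr children q

/-- The first tree of a nonempty forest. -/
def head : ParseForest G (X :: s) → ParseForest G [X]
  | .terminal t _ => .terminal t .nil
  | .node r hr children _ => .node r hr children .nil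

/-- The forest without its first tree. -/
def tail : ParseForest G (X :: s) → ParseForest G s
  | .terminal _ rest => rest
  | .node _ _ _ rest => rest

/-- A nonempty forest is a first tree followed by a forest. -/
def consEquiv : ParseForest G [X] × ParseForest G s ≃ ParseForest G (X :: s) where
  toFun p := cons p.1 p.2
  invFun p := (p.head, p.tail)
  left_inv := by
    rintro ⟨_ | ⟨t, ⟨⟩⟩ | ⟨r, hr, c, ⟨⟩⟩, q⟩ <;> rfl
  right_inv := by
    rintro (_ | _ | _) <;> rfl

theorem cons_injective2 : Function.Injective2 (cons (G := G) (X := X) (s := s)) :=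
  fun p p' q q' h => Prod.mk.inj (consEquiv.injective (a₁ := (p, q)) (a₂ := (p', q')) h)

theorem yield_cons (p : ParseForest G [X]) (q : ParseForest G s) :
    (cons p q).yield = p.yield ++ q.yield := by
  rcases p with _ | ⟨t, ⟨⟩⟩ | ⟨r, hr, c, ⟨⟩⟩ <;> simp [cons, yield]

theorem size_cons (p : ParseForest G [X]) (q : ParseForest G s) :
    (cons p q).size = p.size + q.size := by
  rcases p with _ | ⟨t, ⟨⟩⟩ | ⟨r, hr, c, ⟨⟩⟩ <;> grind [cons, size]

/-- A tree is the choice of a rule and a forest for the right-hand side of this rule. -/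
def nodeEquiv (A : G.NT) :
    (Σ r : {r : ContextFreeRule T G.NT // r ∈ G.rules ∧ r.input = A}, ParseForest G r.1.output) ≃
      ParseForest G [Symbol.nonterminal A] where
  toFun
    | ⟨⟨r, hr, h⟩, c⟩ => h ▸ .node r hr c .nil
  invFun
    | .node r hr children _ => ⟨⟨r, hr, rfl⟩, children⟩
  left_inv := by
    rintro ⟨⟨r, hr, rfl⟩, c⟩
    rfl
  right_inv := by
    rintro (_ | _ | ⟨r, hr, c, ⟨⟩⟩)
    rfl

theorem yield_nodeEquiv (A : G.NT)
    (p : Σ r : {r : ContextFreeRule T G.NT // r ∈ G.rules ∧ r.input = A},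
      ParseForest G r.1.output) :
    (nodeEquiv A p).yield = p.2.yield := by
  obtain ⟨⟨r, hr, rfl⟩, c⟩ := p
  exact List.append_nil _

instance : Unique (ParseForest G []) :=
  ⟨⟨.nil⟩, by rintro ⟨⟩; rfl⟩

instance (t : T) : Unique (ParseForest G [Symbol.terminal t]) :=
  ⟨⟨.terminal t .nil⟩, by rintro (_ | ⟨_, ⟨⟩⟩ | _); rfl⟩

/-- The forests with a given yield. -/
abbrev OfYield (G : ContextFreeGrammar T) (s : List (Symbol T G.NT)) (w : List T) : Type _ :=
  {p : ParseForest G s // p.yield = w}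

/-- A nonempty forest with a given yield is a pair of a tree and a forest whose yields concatenate
to it. -/
def ofYieldConsEquiv (w : List T) :
    {p : ParseForest G [X] × ParseForest G s // p.1.yield ++ p.2.yield = w} ≃
      OfYield G (X :: s) w :=
  consEquiv.subtypeEquiv fun p => by rw [← yield_cons]; rfl

/-- A tree with a given yield is the choice of a rule and a forest with this yield. -/
def ofYieldNodeEquiv (A : G.NT) (w : List T) :
    (Σ r : {r : ContextFreeRule T G.NT // r ∈ G.rules ∧ r.input = A}, OfYield G r.1.output w) ≃
      OfYield G [Symbol.nonterminal A] w where
  toFun p := ⟨nodeEquiv A ⟨p.1, p.2.1⟩, by rw [yield_nodeEquiv, p.2.2]⟩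
  invFun p := ⟨((nodeEquiv A).symm p.1).1, ((nodeEquiv A).symm p.1).2, by
    rw [← yield_nodeEquiv, Equiv.apply_symm_apply, p.2]⟩
  left_inv := by
    rintro ⟨⟨r, hr, rfl⟩, c⟩
    rfl
  right_inv p := Subtype.ext ((nodeEquiv A).right_inv p.1)

end ParseForest

open ParseForest

/-! ### Tame strings and enlargements of trees -/

/-- The string `s` of symbols generates at least one terminal string, and every terminal string in
only finitely many ways. -/
def Tame (G : ContextFreeGrammar T) (s : List (Symbol T G.NT)) : Prop :=
  Nonempty (ParseForest G s) ∧ ∀ w, Finite (OfYield G s w)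

namespace Tame

theorem of_injective {s s' : List (Symbol T G.NT)} (hs : Tame G s)
    (hs' : Nonempty (ParseForest G s')) {f : ParseForest G s' → ParseForest G s}
    (hf : Function.Injective f) (φ : List T → List T) (hφ : ∀ p, (f p).yield = φ p.yield) :
    Tame G s' := by
  refine ⟨hs', fun w => ?_⟩
  have := hs.2 (φ w)
  exact Finite.of_injective
    (fun p : OfYield G s' w => (⟨f p.1, by rw [hφ, p.2]⟩ : OfYield G s (φ w)))
    fun p q h => Subtype.ext (hf (congrArg Subtype.val h))

theorem head {X : Symbol T G.NT} {s : List (Symbol T G.NT)} (h : Tame G (X :: s)) :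
    Tame G [X] := by
  obtain ⟨p⟩ := h.1
  exact h.of_injective ⟨p.head⟩ (cons_injective2.left p.tail) (· ++ p.tail.yield)
    fun q => yield_cons q p.tail

theorem tail {X : Symbol T G.NT} {s : List (Symbol T G.NT)} (h : Tame G (X :: s)) :
    Tame G s := by
  obtain ⟨p⟩ := h.1
  exact h.of_injective ⟨p.tail⟩ (cons_injective2.right p.head) (p.head.yield ++ ·)
    fun q => yield_cons p.head q

theorem of_mem {s : List (Symbol T G.NT)} (h : Tame G s) {X : Symbol T G.NT} (hX : X ∈ s) :
    Tame G [X] := by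
  induction s with
  | nil => cases hX
  | cons Y s ih =>
    rcases List.mem_cons.1 hX with rfl | hX
    exacts [h.head, ih h.tail hX]

theorem output {r : ContextFreeRule T G.NT} (h : Tame G [Symbol.nonterminal r.input])
    (hr : r ∈ G.rules) (p : ParseForest G r.output) : Tame G r.output :=
  h.of_injective ⟨p⟩ (f := fun c => .node r hr c .nil)
    (fun _ _ hc => by simpa using hc) id fun c => List.append_nil c.yield

end Tame

/-- The tame nonterminals of a grammar. -/
abbrev TameNT (G : ContextFreeGrammar T) : Type _ :=
  {A : G.NT // Tame G [Symbol.nonterminal A]}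

noncomputable instance : Fintype (TameNT G) := by
  have hfin : {A | Tame G [Symbol.nonterminal A]}.Finite := by
    refine (G.rules.finite_toSet.image ContextFreeRule.input).subset ?_
    rintro A ⟨⟨_ | _ | ⟨r, hr, _, _⟩⟩, _⟩
    exact ⟨r, hr, rfl⟩
  exact hfin.fintype

noncomputable instance : DecidableEq (TameNT G) :=
  Classical.decEq _

/-- The trees with root label `B` can be enlarged to trees with root label `A` and the same
yield: `A` derives `x B y` in at least one step for strings `x`, `y` that derive `ε`. -/
def Enlarges (G : ContextFreeGrammar T) (A B : G.NT) : Prop :=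
  ∃ f : ParseForest G [Symbol.nonterminal B] → ParseForest G [Symbol.nonterminal A],
    ∀ t, (f t).yield = t.yield ∧ t.size < (f t).size

theorem Enlarges.trans {A B C : G.NT} : Enlarges G A B → Enlarges G B C → Enlarges G A C := by
  rintro ⟨f, hf⟩ ⟨g, hg⟩
  exact ⟨f ∘ g, fun t => ⟨(hf _).1.trans (hg _).1, (hg _).2.trans (hf _).2⟩⟩

/-- Iterating an enlargement would produce infinitely many trees with the same yield. -/
theorem Tame.not_enlarges_self {A : G.NT} (hA : Tame G [Symbol.nonterminal A]) :
    ¬ Enlarges G A A := by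
  rintro ⟨f, hf⟩
  obtain ⟨t⟩ := hA.1
  have hyield (n : ℕ) : (f^[n] t).yield = t.yield := by
    induction n with
    | zero => rfl
    | succ n ih => rw [Function.iterate_succ_apply', (hf _).1, ih]
  have hsize : StrictMono fun n => (f^[n] t).size :=
    strictMono_nat_of_lt_succ fun n => by
      rw [Function.iterate_succ_apply']
      exact (hf _).2
  have := hA.2 t.yield
  exact not_injective_infinite_finite
    (fun n => (⟨f^[n] t, hyield n⟩ : OfYield G [Symbol.nonterminal A] t.yield))
    fun m n h => hsize.injective (congrArg (fun p => p.1.size) h)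

theorem wellFounded_enlarges : WellFounded fun B A : TameNT G => Enlarges G A.1 B.1 :=
  have : IsTrans (TameNT G) fun B A => Enlarges G A.1 B.1 := ⟨fun _ _ _ h h' => h'.trans h⟩
  have : Std.Irrefl fun B A : TameNT G => Enlarges G A.1 B.1 := ⟨fun A => A.2.not_enlarges_self⟩
  Finite.wellFounded_of_trans_of_irrefl _

/-! ### Counting forests -/

section Count

variable (R : Type*) [CommSemiring R]

/-- The number of forests with root labels `s` and yield `w`, as an element of `R`. -/
noncomputable def count (G : ContextFreeGrammar T) (s : List (Symbol T G.NT)) (w : List T) : R :=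
  (Nat.card (OfYield G s w) : R)

variable {R} in
theorem nonempty_of_count_ne_zero {s : List (Symbol T G.NT)} {w : List T}
    (h : count R G s w ≠ 0) : Nonempty (OfYield G s w) := by
  by_contra hn
  rw [not_nonempty_iff] at hn
  exact h (by simp [count])

theorem count_of_unique [DecidableEq T] {s : List (Symbol T G.NT)} [Unique (ParseForest G s)]
    (w : List T) : count R G s w = if w = (default : ParseForest G s).yield then 1 else 0 := by
  split_ifs with h
  · have : Unique (OfYield G s w) := ⟨⟨⟨default, h.symm⟩⟩, fun _ => Subsingleton.elim _ _⟩
    simp [count]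
  · have : IsEmpty (OfYield G s w) := ⟨fun p => h (by rw [← p.2, Unique.eq_default p.1])⟩
    simp [count]

theorem count_nil (w : List T) : count R G [] w = if w = [] then 1 else 0 := by
  classical
  exact (count_of_unique R w).trans (if_congr Iff.rfl rfl rfl)

theorem count_terminal [DecidableEq T] (t : T) (w : List T) :
    count R G [Symbol.terminal t] w = if w = [t] then 1 else 0 :=
  count_of_unique R w

theorem count_cons {X : Symbol T G.NT} {s : List (Symbol T G.NT)} (h : Tame G (X :: s))
    (w : List T) : count R G (X :: s) w =
      ∑ k ∈ Finset.range (w.length + 1), count R G [X] (w.take k) * count R G s (w.drop k) := by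
  rw [count, ← Nat.card_congr (ofYieldConsEquiv w), card_append_eq _ _ h.head.2 h.tail.2]
  simp [count]

open scoped Classical in
/-- The rules for `A` with a tame right-hand side. -/
noncomputable def tameRules (G : ContextFreeGrammar T) (A : G.NT) :
    Finset (ContextFreeRule T G.NT) :=
  {r ∈ G.rules | r.input = A ∧ Tame G r.output}

theorem mem_tameRules {A : G.NT} {r : ContextFreeRule T G.NT} :
    r ∈ tameRules G A ↔ r ∈ G.rules ∧ r.input = A ∧ Tame G r.output := by
  simp [tameRules]

theorem count_nonterminal {A : G.NT} (hA : Tame G [Symbol.nonterminal A]) (w : List T) :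
    count R G [Symbol.nonterminal A] w = ∑ r ∈ tameRules G A, count R G r.output w := by
  classical
  have hempty (r : ContextFreeRule T G.NT) (hr : r ∈ G.rules) (hrA : r.input = A)
      (hn : ¬ Tame G r.output) : IsEmpty (OfYield G r.output w) := by
    subst hrA
    exact ⟨fun p => hn (hA.output hr p.1)⟩
  have hfin (r : {r : ContextFreeRule T G.NT // r ∈ G.rules ∧ r.input = A}) :
      Finite (OfYield G r.1.output w) := by
    by_cases h : Tame G r.1.output
    · exact h.2 w
    · have := hempty r.1 r.2.1 r.2.2 h
      infer_instance
  have hmem (r : ContextFreeRule T G.NT) :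
      r ∈ G.rules.filter (·.input = A) ↔ r ∈ G.rules ∧ r.input = A := Finset.mem_filter
  let _ : Fintype {r : ContextFreeRule T G.NT // r ∈ G.rules ∧ r.input = A} :=
    Fintype.subtype _ hmem
  calc count R G [Symbol.nonterminal A] w
      = ∑ r : {r : ContextFreeRule T G.NT // r ∈ G.rules ∧ r.input = A},
          count R G r.1.output w := by
        rw [count, ← Nat.card_congr (ofYieldNodeEquiv A w), Nat.card_sigma, Nat.cast_sum]
        rfl
    _ = ∑ r ∈ G.rules with r.input = A, count R G r.output w :=
        (Finset.sum_subtype _ hmem fun r => count R G r.output w).symm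
    _ = ∑ r ∈ tameRules G A, count R G r.output w := by
        refine (Finset.sum_subset (fun r hr => ?_) fun r hr hn => ?_).symm
        · rw [mem_tameRules] at hr
          exact (hmem r).2 ⟨hr.1, hr.2.1⟩
        · obtain ⟨hr, hrA⟩ := (hmem r).1 hr
          have := hempty r hr hrA fun h => hn (mem_tameRules.2 ⟨hr, hrA, h⟩)
          simp [count]

end Count

/-! ### The determinant of the linear system -/

section SystemMatrix

variable {R : Type*} [CommRing R]

theorem exists_yield_eq_nil {s : List (Symbol T G.NT)}
    (h : (s.map fun X => count R G [X] []).prod ≠ 0) : ∃ p : ParseForest G s, p.yield = [] := by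
  induction s with
  | nil => exact ⟨.nil, rfl⟩
  | cons X s ih =>
    rw [List.map_cons, List.prod_cons] at h
    obtain ⟨p, hp⟩ := nonempty_of_count_ne_zero (left_ne_zero_of_mul h)
    obtain ⟨q, hq⟩ := ih (right_ne_zero_of_mul h)
    exact ⟨cons p q, by rw [yield_cons, hp, hq, List.nil_append]⟩

open scoped Classical in
theorem exists_context_of_skewDeriv_ne_zero {B : G.NT} {s : List (Symbol T G.NT)}
    (h : skewDeriv (fun X => count R G [X] []) (fun X => count R G [X] []) s
      (Pi.single (Symbol.nonterminal B) 1) ≠ 0) :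
    ∃ f : ParseForest G [Symbol.nonterminal B] → ParseForest G s,
      ∀ t, (f t).yield = t.yield ∧ t.size ≤ (f t).size := by
  induction s with
  | nil => exact absurd rfl h
  | cons X s ih =>
    rw [skewDeriv_cons] at h
    by_cases hs : count R G [X] [] * skewDeriv (fun X => count R G [X] [])
        (fun X => count R G [X] []) s (Pi.single (Symbol.nonterminal B) 1) = 0
    · rw [hs, add_zero] at h
      obtain rfl : X = Symbol.nonterminal B := by
        by_contra hX
        exact right_ne_zero_of_mul h (Pi.single_eq_of_ne hX 1)
      obtain ⟨q, hq⟩ := exists_yield_eq_nil (left_ne_zero_of_mul h)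
      exact ⟨fun t => cons t q, fun t => by simp [yield_cons, size_cons, hq]⟩
    · obtain ⟨p, hp⟩ := nonempty_of_count_ne_zero (left_ne_zero_of_mul hs)
      obtain ⟨f, hf⟩ := ih (right_ne_zero_of_mul hs)
      exact ⟨fun t => cons p (f t), fun t =>
        ⟨by rw [yield_cons, hp, (hf t).1, List.nil_append],
          (hf t).2.trans (by rw [size_cons]; exact Nat.le_add_left _ _)⟩⟩

open scoped Classical in
/-- The matrix of a linear system for the series of the tame nonterminals: the entry at `(A, B)`
collects the occurrences of `B` in the rules for `A`, a symbol being weighted by `α` to the left of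
the occurrence and by `β` to the right of it. -/
noncomputable def systemMatrix (G : ContextFreeGrammar T) (α β : Symbol T G.NT → R) :
    Matrix (TameNT G) (TameNT G) R :=
  .of fun A B => ∑ r ∈ tameRules G A.1,
    skewDeriv α β r.output (Pi.single (Symbol.nonterminal B.1) 1)

theorem enlarges_of_systemMatrix_ne_zero {A B : TameNT G}
    (h : systemMatrix G (fun X => count R G [X] []) (fun X => count R G [X] []) A B ≠ 0) :
    Enlarges G A.1 B.1 := by
  obtain ⟨A, _⟩ := A
  obtain ⟨r, hrA, hr⟩ := Finset.exists_ne_zero_of_sum_ne_zero h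
  obtain ⟨hrG, rfl, -⟩ := mem_tameRules.1 hrA
  obtain ⟨f, hf⟩ := exists_context_of_skewDeriv_ne_zero hr
  refine ⟨fun t => .node r hrG (f t) .nil, fun t => ?_⟩
  simp only [yield, size, List.append_nil, (hf t).1, true_and]
  have := (hf t).2
  omega

theorem map_systemMatrix {S : Type*} [CommRing S] (φ : S →+* R) (α β : Symbol T G.NT → S) :
    (systemMatrix G α β).map φ = systemMatrix G (φ ∘ α) (φ ∘ β) := by
  classical
  ext A B
  simp only [systemMatrix, Matrix.map_apply, Matrix.of_apply, map_sum, map_skewDeriv]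
  congr! 2 with r
  ext X
  simp [Pi.single_apply, apply_ite φ]

theorem det_one_sub_systemMatrix_ne_zero [IsDomain R] {S : Type*} [CommRing S] (φ : S →+* R)
    {α β : Symbol T G.NT → S} (hα : ∀ X, φ (α X) = count R G [X] [])
    (hβ : ∀ X, φ (β X) = count R G [X] []) : (1 - systemMatrix G α β).det ≠ 0 := by
  have hφα : φ ∘ α = fun X => count R G [X] [] := funext hα
  have hφβ : φ ∘ β = fun X => count R G [X] [] := funext hβ
  have hdet : φ (1 - systemMatrix G α β).det =
      (1 - systemMatrix G (fun X => count R G [X] []) (fun X => count R G [X] [])).det := by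
    rw [RingHom.map_det, map_sub, map_one, RingHom.mapMatrix_apply, map_systemMatrix, hφα, hφβ]
  refine fun h => det_one_sub_ne_zero_of_wellFounded (wellFounded_enlarges (G := G))
    (fun _ _ => enlarges_of_systemMatrix_ne_zero (R := R)) ?_
  exact hdet.symm.trans (by rw [h, map_zero])

end SystemMatrix

/-! ### The univariate series are algebraic -/

section Univariate

variable (k : Type*) [Field k]

/-- The univariate series counting the forests with yield in `c^*`. -/
noncomputable def uniSeries (G : ContextFreeGrammar T) (c : T) (s : List (Symbol T G.NT)) :
    PowerSeries k :=
  PowerSeries.mk fun n => count k G s (List.replicate n c)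

variable (c : T)

theorem uniSeries_nil : uniSeries k G c [] = 1 := by
  ext n
  simp [uniSeries, count_nil, PowerSeries.coeff_one]

theorem uniSeries_cons {X : Symbol T G.NT} {s : List (Symbol T G.NT)} (h : Tame G (X :: s)) :
    uniSeries k G c (X :: s) = uniSeries k G c [X] * uniSeries k G c s := by
  ext n
  rw [PowerSeries.coeff_mul, Finset.Nat.sum_antidiagonal_eq_sum_range_succ_mk]
  simp only [uniSeries, PowerSeries.coeff_mk, count_cons k h, List.length_replicate,
    List.take_replicate, List.drop_replicate]
  refine Finset.sum_congr rfl fun i hi => ?_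
  rw [min_eq_left (Nat.le_of_lt_succ (Finset.mem_range.1 hi))]

theorem uniSeries_eq_prod {s : List (Symbol T G.NT)} (h : Tame G s) :
    uniSeries k G c s = (s.map fun X => uniSeries k G c [X]).prod := by
  induction s with
  | nil => exact uniSeries_nil k c
  | cons X s ih => rw [uniSeries_cons k c h, ih h.tail, List.map_cons, List.prod_cons]

theorem uniSeries_nonterminal {A : G.NT} (hA : Tame G [Symbol.nonterminal A]) :
    uniSeries k G c [Symbol.nonterminal A] = ∑ r ∈ tameRules G A, uniSeries k G c r.output := by
  ext n
  simp [uniSeries, count_nonterminal k hA]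

theorem uniSeries_terminal [DecidableEq T] (t : T) :
    uniSeries k G c [Symbol.terminal t] = if t = c then PowerSeries.X else 0 := by
  ext n
  have hrep : List.replicate n c = [t] ↔ t = c ∧ n = 1 := by
    rw [← List.replicate_one, List.replicate_inj]
    grind
  rw [uniSeries, PowerSeries.coeff_mk, count_terminal, if_congr hrep rfl rfl]
  by_cases h : t = c <;> simp [h, PowerSeries.coeff_X]

theorem constantCoeff_uniSeries (s : List (Symbol T G.NT)) :
    PowerSeries.constantCoeff (uniSeries k G c s) = count k G s [] := by
  simp [uniSeries, ← PowerSeries.coeff_zero_eq_constantCoeff_apply]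

open scoped Classical in
/-- The polynomial unknown that stands for the univariate series of a symbol. -/
noncomputable def unknown (G : ContextFreeGrammar T) :
    Symbol T G.NT → MvPolynomial (TameNT G) (Polynomial k)
  | .terminal t => MvPolynomial.C (if t = c then Polynomial.X else 0)
  | .nonterminal A => if h : Tame G [.nonterminal A] then MvPolynomial.X ⟨A, h⟩ else 0

theorem aeval_unknown {X : Symbol T G.NT} (hX : Tame G [X]) :
    MvPolynomial.aeval (fun A : TameNT G => uniSeries k G c [Symbol.nonterminal A.1])
      (unknown k c G X) = uniSeries k G c [X] := by
  classical
  cases X with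
  | terminal t =>
    rw [unknown, uniSeries_terminal, MvPolynomial.aeval_C, PowerSeries.algebraMap_apply']
    split_ifs <;> simp
  | nonterminal A => rw [unknown, dif_pos hX, MvPolynomial.aeval_X]

theorem aeval_prod_unknown {s : List (Symbol T G.NT)} (hs : Tame G s) :
    MvPolynomial.aeval (fun A : TameNT G => uniSeries k G c [Symbol.nonterminal A.1])
      (s.map (unknown k c G)).prod = uniSeries k G c s := by
  rw [map_list_prod, List.map_map, uniSeries_eq_prod k c hs]
  exact congrArg _ (List.map_congr_left fun X hX => aeval_unknown k c (hs.of_mem hX))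

open scoped Classical in
theorem pderiv_unknown (B : TameNT G) (X : Symbol T G.NT) :
    MvPolynomial.pderiv B (unknown k c G X) =
      (Pi.single (Symbol.nonterminal B.1) 1 : Symbol T G.NT → _) X := by
  cases X with
  | terminal t => simp [unknown]
  | nonterminal A =>
    by_cases hA : Tame G [Symbol.nonterminal A]
    · simp [unknown, hA, MvPolynomial.pderiv_X, Pi.single_apply, Subtype.ext_iff]
    · have hne : A ≠ B.1 := fun h => hA (h ▸ B.2)
      simp [unknown, hA, hne]

open scoped Classical in
theorem aeval_pderiv_prod_unknown (B : TameNT G) {s : List (Symbol T G.NT)} (hs : Tame G s) :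
    MvPolynomial.aeval (fun A : TameNT G => uniSeries k G c [Symbol.nonterminal A.1])
        (MvPolynomial.pderiv B (s.map (unknown k c G)).prod) =
      skewDeriv (fun X => uniSeries k G c [X]) (fun X => uniSeries k G c [X]) s
        (Pi.single (Symbol.nonterminal B.1) 1) := by
  rw [derivation_list_prod, ← AlgHom.coe_toRingHom, map_skewDeriv]
  refine skewDeriv_congr (fun X hX => aeval_unknown k c (hs.of_mem hX))
    (fun X hX => aeval_unknown k c (hs.of_mem hX)) fun X _ => ?_
  simp [pderiv_unknown, Pi.single_apply, apply_ite]

theorem isAlgebraic_uniSeries_nonterminal (A : TameNT G) :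
    IsAlgebraic (Polynomial k) (uniSeries k G c [Symbol.nonterminal A.1]) := by
  classical
  have : FaithfulSMul (Polynomial k) (PowerSeries k) := by
    rw [faithfulSMul_iff_algebraMap_injective]
    exact fun p q h => by simpa [PowerSeries.algebraMap_apply'] using h
  refine isAlgebraic_of_det_pderiv_ne_zero
    (x := fun A : TameNT G => uniSeries k G c [Symbol.nonterminal A.1])
    (P := fun A => .X A - ∑ r ∈ tameRules G A.1, (r.output.map (unknown k c G)).prod)
    (fun A => ?_) ?_ A
  · rw [map_sub, MvPolynomial.aeval_X, map_sum, sub_eq_zero, uniSeries_nonterminal k c A.2]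
    exact Finset.sum_congr rfl fun r hr =>
      (aeval_prod_unknown k c (mem_tameRules.1 hr).2.2).symm
  · convert det_one_sub_systemMatrix_ne_zero (G := G) PowerSeries.constantCoeff
      (fun X => constantCoeff_uniSeries k c [X]) (fun X => constantCoeff_uniSeries k c [X]) using 2
    ext1 A B
    simp only [Matrix.of_apply, Matrix.sub_apply, systemMatrix, map_sub, map_sum,
      MvPolynomial.pderiv_X]
    congr 1
    · simp [Matrix.one_apply, Pi.single_apply, apply_ite, eq_comm]
    · exact Finset.sum_congr rfl fun r hr =>
        aeval_pderiv_prod_unknown k c B (mem_tameRules.1 hr).2.2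

theorem isAlgebraic_powerSeriesX : IsAlgebraic (Polynomial k) (PowerSeries.X : PowerSeries k) := by
  have hX : algebraMap (Polynomial k) (PowerSeries k) Polynomial.X = PowerSeries.X := by
    simp [PowerSeries.algebraMap_apply']
  exact hX ▸ isAlgebraic_algebraMap _

theorem isAlgebraic_uniSeries {X : Symbol T G.NT} (hX : Tame G [X]) :
    IsAlgebraic (Polynomial k) (uniSeries k G c [X]) := by
  classical
  cases X with
  | terminal t =>
    rw [uniSeries_terminal]
    split_ifs
    exacts [isAlgebraic_powerSeriesX k, isAlgebraic_zero]
  | nonterminal A => exact isAlgebraic_uniSeries_nonterminal k c ⟨A, hX⟩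

end Univariate

/-! ### The algebra of mixed algebraic series -/

section Mixed

variable {k σ : Type*} [Field k]

/-- The substitution of the variable number `i` into univariate series; for `k = 𝔽₂` this is
`inVar`. -/
noncomputable def embedVar (i : σ) : PowerSeries k →ₐ[k] MvPowerSeries σ k :=
  MvPowerSeries.rename fun _ : Unit => i

theorem embedVar_C (i : σ) (x : k) : embedVar i (PowerSeries.C x) = MvPowerSeries.C x :=
  MvPowerSeries.rename_C _ x

theorem embedVar_X (i : σ) : embedVar i (PowerSeries.X : PowerSeries k) = MvPowerSeries.X i :=
  MvPowerSeries.rename_X _ _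

theorem constantCoeff_embedVar (i : σ) (f : PowerSeries k) :
    MvPowerSeries.constantCoeff (embedVar i f) = PowerSeries.constantCoeff f :=
  MvPowerSeries.constantCoeff_rename _ f

theorem coeff_embedVar [DecidableEq σ] (i : σ) (f : PowerSeries k) (e : σ →₀ ℕ) :
    MvPowerSeries.coeff e (embedVar i f) =
      if e = Finsupp.single i (e i) then PowerSeries.coeff (e i) f else 0 := by
  split_ifs with h
  · have hcoeff := MvPowerSeries.coeff_embDomain_rename ⟨fun _ : Unit => i, fun _ _ _ => rfl⟩ f
      (Finsupp.single () (e i))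
    rw [Finsupp.embDomain_single] at hcoeff
    rw [h, Finsupp.single_eq_same]
    exact hcoeff
  · refine MvPowerSeries.coeff_rename_eq_zero _ f ?_
    rintro ⟨g, rfl⟩
    rw [Finsupp.unique_single g, Finsupp.mapDomain_single, Finsupp.single_eq_same] at h
    exact h rfl

theorem coeff_embedVar_mul (i : σ) (f : PowerSeries k) (g : MvPowerSeries σ k) (e : σ →₀ ℕ) :
    MvPowerSeries.coeff e (embedVar i f * g) = ∑ n ∈ Finset.range (e i + 1),
      PowerSeries.coeff n f * MvPowerSeries.coeff (e - Finsupp.single i n) g := by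
  classical
  rw [MvPowerSeries.coeff_mul]
  symm
  refine Finset.sum_of_injOn (fun n => (Finsupp.single i n, e - Finsupp.single i n))
    (fun n _ m _ h => Finsupp.single_injective i (congrArg Prod.fst h)) (fun n hn => ?_) ?_
    fun n _ => by simp [coeff_embedVar]
  · have hn : n ≤ e i := Nat.le_of_lt_succ (by simpa using hn)
    simpa using add_tsub_cancel_of_le (Finsupp.single_le_iff.2 hn)
  · rintro ⟨p, q⟩ hpq hnot
    obtain rfl : p + q = e := by simpa using hpq
    rw [coeff_embedVar, if_neg, zero_mul]
    exact fun hp => hnot ⟨p i, by simp, by simp [← hp]⟩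

/-- The algebraic univariate series, read as series in the variable number `i`. -/
noncomputable def algebraicSeriesIn (k : Type*) [Field k] (i : σ) :
    Subalgebra k (MvPowerSeries σ k) :=
  ((Subalgebra.algebraicClosure (Polynomial k) (PowerSeries k)).restrictScalars k).map (embedVar i)

theorem embedVar_mem_algebraicSeriesIn (i : σ) {f : PowerSeries k}
    (hf : IsAlgebraic (Polynomial k) f) : embedVar i f ∈ algebraicSeriesIn k i :=
  ⟨f, hf, rfl⟩

/-- The algebra generated by the algebraic series in single variables, that is, the sums of products
of such series. -/
noncomputable def mixedAlgebra (σ k : Type*) [Field k] : Subalgebra k (MvPowerSeries σ k) :=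
  ⨆ i : σ, algebraicSeriesIn k i

theorem embedVar_mem_mixedAlgebra (i : σ) {f : PowerSeries k} (hf : IsAlgebraic (Polynomial k) f) :
    embedVar i f ∈ mixedAlgebra σ k :=
  le_iSup (algebraicSeriesIn k) i (embedVar_mem_algebraicSeriesIn i hf)

theorem X_mem_mixedAlgebra (i : σ) : MvPowerSeries.X i ∈ mixedAlgebra σ k := by
  rw [← embedVar_X]
  exact embedVar_mem_mixedAlgebra i (isAlgebraic_powerSeriesX k)

theorem coe_mem_mixedAlgebra (p : MvPolynomial σ k) :
    (p : MvPowerSeries σ k) ∈ mixedAlgebra σ k := by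
  induction p using MvPolynomial.induction_on with
  | C x =>
    rw [MvPolynomial.coe_C]
    exact (mixedAlgebra σ k).algebraMap_mem x
  | add p q hp hq =>
    rw [MvPolynomial.coe_add]
    exact add_mem hp hq
  | mul_X p i hp =>
    rw [MvPolynomial.coe_mul, MvPolynomial.coe_X]
    exact mul_mem hp (X_mem_mixedAlgebra i)

theorem algebraMap_eq_coe (p : MvPolynomial σ k) :
    algebraMap (MvPolynomial σ k) (MvPowerSeries σ k) p = p := by
  simp [MvPowerSeries.algebraMap_apply']

theorem isAlgebraic_embedVar (i : σ) {f : PowerSeries k} (hf : IsAlgebraic (Polynomial k) f) :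
    IsAlgebraic (MvPolynomial σ k) (embedVar i f) := by
  refine IsAlgebraic.ringHom_of_comp_eq
    (Polynomial.aeval (R := k) (MvPolynomial.X (R := k) i)).toRingHom
    (embedVar i).toRingHom hf ?_ ?_
  · exact transcendental_iff_injective.1 (MvPolynomial.transcendental_X k i)
  · refine Polynomial.ringHom_ext (fun x => ?_) ?_ <;>
      simp [PowerSeries.algebraMap_apply', algebraMap_eq_coe, embedVar_C, embedVar_X]

theorem isAlgebraic_of_mem_mixedAlgebra {g : MvPowerSeries σ k} (hg : g ∈ mixedAlgebra σ k) :
    IsAlgebraic (MvPolynomial σ k) g := by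
  have hle : mixedAlgebra σ k ≤ (Subalgebra.algebraicClosure (MvPolynomial σ k)
      (MvPowerSeries σ k)).restrictScalars k := by
    refine iSup_le fun i => ?_
    rintro _ ⟨f, hf, rfl⟩
    exact isAlgebraic_embedVar i hf
  exact hle hg

theorem exists_mul_eq_coe {d : MvPowerSeries σ k} (hd : d ∈ mixedAlgebra σ k) (h0 : d ≠ 0) :
    ∃ y ∈ mixedAlgebra σ k, ∃ p : MvPolynomial σ k, p ≠ 0 ∧ y * d = p := by
  let C : Subalgebra (MvPolynomial σ k) (MvPowerSeries σ k) :=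
    { toSubsemiring := (mixedAlgebra σ k).toSubsemiring
      algebraMap_mem' := fun p => by
        rw [algebraMap_eq_coe]
        exact coe_mem_mixedAlgebra p }
  have halg : IsAlgebraic (MvPolynomial σ k) (⟨d, hd⟩ : C) :=
    Subalgebra.isAlgebraic_iff_isAlgebraic_val.2 (isAlgebraic_of_mem_mixedAlgebra hd)
  obtain ⟨p, hp, ⟨y, hy⟩, hdvd⟩ := halg.exists_nonzero_dvd
    (mem_nonZeroDivisors_of_ne_zero fun h => h0 (congrArg Subtype.val h))
  refine ⟨y, hy, p, hp, ?_⟩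
  rw [← algebraMap_eq_coe, mul_comm]
  exact (congrArg Subtype.val hdvd).symm

end Mixed

/-! ### The bivariate series -/

section Bivariate

variable (k : Type*) [Field k]

/-- The bivariate series counting the forests with yield `a^n b^m`. -/
noncomputable def biSeries (G : ContextFreeGrammar T) (a b : T) (s : List (Symbol T G.NT)) :
    MvPowerSeries (Fin 2) k :=
  fun e => count k G s (List.replicate (e 0) a ++ List.replicate (e 1) b)

variable (a b : T)

theorem coeff_biSeries (s : List (Symbol T G.NT)) (e : Fin 2 →₀ ℕ) :
    MvPowerSeries.coeff e (biSeries k G a b s) =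
      count k G s (List.replicate (e 0) a ++ List.replicate (e 1) b) :=
  rfl

theorem biSeries_nil : biSeries k G a b [] = 1 := by
  ext e
  simp [coeff_biSeries, count_nil, MvPowerSeries.coeff_one, Finsupp.ext_iff]

theorem biSeries_nonterminal {A : G.NT} (hA : Tame G [Symbol.nonterminal A]) :
    biSeries k G a b [Symbol.nonterminal A] = ∑ r ∈ tameRules G A, biSeries k G a b r.output := by
  ext e
  simp [coeff_biSeries, count_nonterminal k hA]

theorem biSeries_terminal [DecidableEq T] (t : T) :
    biSeries k G a b [Symbol.terminal t] =
      (if t = a then MvPowerSeries.X 0 else 0) + (if t = b then MvPowerSeries.X 1 else 0) := by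
  have hword (n m : ℕ) : List.replicate n a ++ List.replicate m b = [t] ↔
      (n = 1 ∧ m = 0 ∧ t = a) ∨ (n = 0 ∧ m = 1 ∧ t = b) := by
    rcases n with _ | _ | n <;> rcases m with _ | _ | m <;>
      simp [List.replicate_succ, eq_comm (b := t)]
  ext e
  have h0 : e = Finsupp.single 0 1 ↔ e 0 = 1 ∧ e 1 = 0 := by simp [Finsupp.ext_iff]
  have h1 : e = Finsupp.single 1 1 ↔ e 0 = 0 ∧ e 1 = 1 := by simp [Finsupp.ext_iff]
  rw [coeff_biSeries, count_terminal, if_congr (hword _ _) rfl rfl, map_add,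
    apply_ite (MvPowerSeries.coeff e), apply_ite (MvPowerSeries.coeff e),
    map_zero (MvPowerSeries.coeff e), MvPowerSeries.coeff_X, MvPowerSeries.coeff_X,
    if_congr h0 rfl rfl, if_congr h1 rfl rfl]
  grind

theorem count_cons_replicate_append {X : Symbol T G.NT} {s : List (Symbol T G.NT)}
    (h : Tame G (X :: s)) (n m : ℕ) :
    count k G (X :: s) (List.replicate n a ++ List.replicate m b) =
      ∑ i ∈ Finset.range n, count k G [X] (List.replicate i a) *
        count k G s (List.replicate (n - i) a ++ List.replicate m b) +
      ∑ j ∈ Finset.range (m + 1), count k G [X] (List.replicate n a ++ List.replicate (m - j) b) *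
        count k G s (List.replicate j b) := by
  rw [count_cons k h, List.length_append, List.length_replicate, List.length_replicate, add_assoc,
    Finset.sum_range_add, ← Finset.sum_range_reflect _ (m + 1)]
  congr 1 <;> refine Finset.sum_congr rfl fun i hi => ?_
  · have hi := (Finset.mem_range.1 hi).le
    simp [List.take_append, List.drop_append, Nat.sub_eq_zero_of_le hi, hi]
  · have hi := Nat.le_of_lt_succ (Finset.mem_range.1 hi)
    simp [List.take_append, List.drop_append, Nat.sub_sub_self hi]

theorem coeff_embedVar_zero_mul_embedVar_one (f g : PowerSeries k) (e : Fin 2 →₀ ℕ) :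
    MvPowerSeries.coeff e (embedVar 0 f * embedVar 1 g) =
      PowerSeries.coeff (e 0) f * PowerSeries.coeff (e 1) g := by
  rw [coeff_embedVar_mul, Finset.sum_eq_single (e 0) (fun n hn hne => ?_) (by simp)]
  · rw [coeff_embedVar, if_pos]
    · simp
    · ext j
      fin_cases j <;> simp
  · rw [coeff_embedVar, if_neg, mul_zero]
    intro h
    have h0 : e 0 - n = 0 := by simpa using DFunLike.congr_fun h 0
    have hn := Finset.mem_range.1 hn
    omega

/-- A prefix of `a^n b^m` is a power of `a`, or `a^n` followed by a power of `b`; the subtracted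
term compensates for the prefix `a^n`, which is both. -/
theorem biSeries_cons {X : Symbol T G.NT} {s : List (Symbol T G.NT)} (h : Tame G (X :: s)) :
    biSeries k G a b (X :: s) = embedVar 0 (uniSeries k G a [X]) * biSeries k G a b s +
      (biSeries k G a b [X] - embedVar 0 (uniSeries k G a [X])) *
        embedVar 1 (uniSeries k G b s) := by
  ext e
  rw [sub_mul, mul_comm (biSeries k G a b [X]), map_add, map_sub,
    coeff_embedVar_zero_mul_embedVar_one, coeff_embedVar_mul, coeff_embedVar_mul, coeff_biSeries,
    count_cons_replicate_append k a b h, Finset.sum_range_succ _ (e 0)]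
  simp [coeff_biSeries, uniSeries, mul_comm]

/-- The univariate series of a symbol for the letter `c`, read as a series in the variable
number `i`. These are the coefficients of the linear system for the bivariate series. -/
noncomputable def symbolSeries (G : ContextFreeGrammar T) (i : Fin 2) (c : T) (X : Symbol T G.NT) :
    MvPowerSeries (Fin 2) k :=
  embedVar i (uniSeries k G c [X])

theorem constantCoeff_symbolSeries (i : Fin 2) (c : T) (X : Symbol T G.NT) :
    MvPowerSeries.constantCoeff (symbolSeries k G i c X) = count k G [X] [] := by
  rw [symbolSeries, constantCoeff_embedVar, constantCoeff_uniSeries]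

theorem symbolSeries_mem_mixedAlgebra (i : Fin 2) (c : T) {X : Symbol T G.NT} (hX : Tame G [X]) :
    symbolSeries k G i c X ∈ mixedAlgebra (Fin 2) k :=
  embedVar_mem_mixedAlgebra i (isAlgebraic_uniSeries k c hX)

theorem embedVar_uniSeries_eq_prod (i : Fin 2) (c : T) {s : List (Symbol T G.NT)} (h : Tame G s) :
    embedVar i (uniSeries k G c s) = (s.map (symbolSeries k G i c)).prod := by
  rw [uniSeries_eq_prod k c h, map_list_prod, List.map_map]
  rfl

theorem biSeries_eq_skewDeriv_add_prod {s : List (Symbol T G.NT)} (h : Tame G s) :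
    biSeries k G a b s =
      skewDeriv (symbolSeries k G 0 a) (symbolSeries k G 1 b) s
        (fun X => biSeries k G a b [X] - symbolSeries k G 0 a X) +
      (s.map (symbolSeries k G 0 a)).prod := by
  induction s with
  | nil => simp [biSeries_nil]
  | cons X s ih =>
    rw [biSeries_cons k a b h, ih h.tail, embedVar_uniSeries_eq_prod k 1 b h.tail, ← symbolSeries,
      skewDeriv_cons, List.map_cons, List.prod_cons]
    ring

/-- The part of `biSeries k G a b [X] - symbolSeries k G 0 a X` that does not involve the unknown
bivariate series of the nonterminals. -/
noncomputable def knownPart (G : ContextFreeGrammar T) (a b : T) :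
    Symbol T G.NT → MvPowerSeries (Fin 2) k
  | .terminal t => biSeries k G a b [.terminal t] - symbolSeries k G 0 a (.terminal t)
  | .nonterminal A => -symbolSeries k G 0 a (.nonterminal A)

open scoped Classical in
theorem biSeries_sub_symbolSeries {X : Symbol T G.NT} (hX : Tame G [X]) :
    biSeries k G a b [X] - symbolSeries k G 0 a X = knownPart k G a b X +
      ∑ B : TameNT G, biSeries k G a b [.nonterminal B.1] *
        (Pi.single (Symbol.nonterminal B.1) 1 : Symbol T G.NT → _) X := by
  cases X with
  | terminal t => simp [knownPart]
  | nonterminal A =>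
    rw [Finset.sum_eq_single ⟨A, hX⟩ (fun B _ hB => ?_) (by simp)]
    · simp [knownPart, sub_eq_neg_add]
    · have hne : A ≠ B.1 := fun h => hB (Subtype.ext h.symm)
      simp [hne]

theorem knownPart_mem_mixedAlgebra {X : Symbol T G.NT} (hX : Tame G [X]) :
    knownPart k G a b X ∈ mixedAlgebra (Fin 2) k := by
  classical
  cases X with
  | terminal t =>
    refine sub_mem ?_ (symbolSeries_mem_mixedAlgebra k 0 a hX)
    rw [biSeries_terminal]
    refine add_mem ?_ ?_ <;> split_ifs
    exacts [X_mem_mixedAlgebra 0, zero_mem _, X_mem_mixedAlgebra 1, zero_mem _]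
  | nonterminal A => exact neg_mem (symbolSeries_mem_mixedAlgebra k 0 a hX)

/-- The matrix of the linear system for the bivariate series. -/
noncomputable def biMatrix (G : ContextFreeGrammar T) (a b : T) :
    Matrix (TameNT G) (TameNT G) (MvPowerSeries (Fin 2) k) :=
  1 - systemMatrix G (symbolSeries k G 0 a) (symbolSeries k G 1 b)

theorem det_biMatrix_ne_zero : (biMatrix k G a b).det ≠ 0 :=
  det_one_sub_systemMatrix_ne_zero MvPowerSeries.constantCoeff
    (constantCoeff_symbolSeries k 0 a) (constantCoeff_symbolSeries k 1 b)

theorem biMatrix_mem_mixedAlgebra (A B : TameNT G) :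
    biMatrix k G a b A B ∈ mixedAlgebra (Fin 2) k := by
  classical
  have hone : (1 : Matrix (TameNT G) (TameNT G) _) A B ∈ mixedAlgebra (Fin 2) k := by
    rw [Matrix.one_apply]
    split_ifs
    exacts [one_mem _, zero_mem _]
  refine sub_mem hone (sum_mem fun r hr => ?_)
  have hsym (i : Fin 2) (c : T) (X) (hX : X ∈ r.output) :=
    symbolSeries_mem_mixedAlgebra k i c ((mem_tameRules.1 hr).2.2.of_mem hX)
  refine skewDeriv_mem (hsym 0 a) (hsym 1 b) fun X _ => ?_
  rw [Pi.single_apply]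
  split_ifs
  exacts [one_mem _, zero_mem _]

theorem biMatrix_mulVec_biSeries (A : TameNT G) :
    (biMatrix k G a b).mulVec (fun B => biSeries k G a b [Symbol.nonterminal B.1]) A =
      ∑ r ∈ tameRules G A.1,
        (skewDeriv (symbolSeries k G 0 a) (symbolSeries k G 1 b) r.output (knownPart k G a b) +
          (r.output.map (symbolSeries k G 0 a)).prod) := by
  classical
  have hrule (r) (hr : r ∈ tameRules G A.1) : biSeries k G a b r.output =
      skewDeriv (symbolSeries k G 0 a) (symbolSeries k G 1 b) r.output (knownPart k G a b) +
      (r.output.map (symbolSeries k G 0 a)).prod +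
      ∑ B : TameNT G, skewDeriv (symbolSeries k G 0 a) (symbolSeries k G 1 b) r.output
        (Pi.single (Symbol.nonterminal B.1) 1) * biSeries k G a b [.nonterminal B.1] := by
    have houtput := (mem_tameRules.1 hr).2.2
    rw [biSeries_eq_skewDeriv_add_prod k a b houtput,
      skewDeriv_congr (δ' := knownPart k G a b + ∑ B : TameNT G,
        biSeries k G a b [.nonterminal B.1] • Pi.single (Symbol.nonterminal B.1) 1)
        (fun _ _ => rfl) (fun _ _ => rfl) fun X hX => ?_]
    · simp only [map_add, map_sum, map_smul, smul_eq_mul, mul_comm]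
      ring
    · simp [biSeries_sub_symbolSeries k a b (houtput.of_mem hX)]
  rw [biMatrix, Matrix.sub_mulVec, Matrix.one_mulVec, Pi.sub_apply,
    biSeries_nonterminal k a b A.2, Finset.sum_congr rfl hrule, Finset.sum_add_distrib,
    Finset.sum_comm]
  simp [Matrix.mulVec, dotProduct, systemMatrix, Finset.sum_mul]

theorem exists_coe_mul_biSeries_mem_mixedAlgebra (A : TameNT G) :
    ∃ p : MvPolynomial (Fin 2) k, p ≠ 0 ∧
      p * biSeries k G a b [Symbol.nonterminal A.1] ∈ mixedAlgebra (Fin 2) k := by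
  have hright (B : TameNT G) :
      (biMatrix k G a b).mulVec (fun B => biSeries k G a b [Symbol.nonterminal B.1]) B ∈
        mixedAlgebra (Fin 2) k := by
    rw [biMatrix_mulVec_biSeries]
    refine sum_mem fun r hr => ?_
    have houtput := (mem_tameRules.1 hr).2.2
    have hsym (i : Fin 2) (c : T) (X) (hX : X ∈ r.output) :=
      symbolSeries_mem_mixedAlgebra k i c (houtput.of_mem hX)
    refine add_mem (skewDeriv_mem (hsym 0 a) (hsym 1 b) fun X hX => ?_) (list_prod_mem ?_)
    · exact knownPart_mem_mixedAlgebra k a b (houtput.of_mem hX)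
    · simpa using hsym 0 a
  have hmatrix := biMatrix_mem_mixedAlgebra k (G := G) a b
  obtain ⟨y, hy, p, hp, hyp⟩ := exists_mul_eq_coe (det_mem hmatrix) (det_biMatrix_ne_zero k a b)
  refine ⟨p, hp, ?_⟩
  rw [← hyp, mul_assoc]
  exact mul_mem hy (det_mul_mem_of_mulVec_mem hmatrix hright A)

end Bivariate

/-! ### Dual series of languages -/

theorem exists_eq_sum_of_mem_mixedAlgebra {f : MvPowerSeries (Fin 2) (ZMod 2)}
    (hf : f ∈ mixedAlgebra (Fin 2) (ZMod 2)) :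
    ∃ (n : ℕ) (A B : Fin n → MvPowerSeries (Fin 2) (ZMod 2)),
      (∀ i, A i ∈ algSeries 0) ∧ (∀ i, B i ∈ algSeries 1) ∧ f = ∑ i, A i * B i := by
  have hmem (i : Fin 2) {g} (hg : g ∈ algebraicSeriesIn (ZMod 2) i) : g ∈ algSeries i := by
    obtain ⟨f, hf, rfl⟩ := hg
    exact ⟨f, hf, rfl⟩
  have hsup : mixedAlgebra (Fin 2) (ZMod 2) =
      algebraicSeriesIn (ZMod 2) 0 ⊔ algebraicSeriesIn (ZMod 2) 1 := by
    refine le_antisymm (iSup_le (Fin.forall_fin_two.2 ⟨le_sup_left, le_sup_right⟩))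
      (sup_le (le_iSup _ 0) (le_iSup _ 1))
  rw [hsup, ← Subalgebra.mem_toSubmodule, ← Subalgebra.mul_toSubmodule] at hf
  refine Submodule.mul_induction_on hf (fun g hg h hh => ?_) ?_
  · exact ⟨1, fun _ => g, fun _ => h, fun _ => hmem 0 hg, fun _ => hmem 1 hh, by simp⟩
  · rintro _ _ ⟨n, A, B, hA, hB, rfl⟩ ⟨m, A', B', hA', hB', rfl⟩
    refine ⟨n + m, Fin.append A A', Fin.append B B', Fin.addCases ?_ ?_, Fin.addCases ?_ ?_, ?_⟩
    all_goals simp [Fin.sum_univ_add, *]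

theorem algebraMap_mem_Rab {f : MvPowerSeries (Fin 2) (ZMod 2)}
    {p : MvPolynomial (Fin 2) (ZMod 2)} (hp : p ≠ 0)
    (hpf : p * f ∈ mixedAlgebra (Fin 2) (ZMod 2)) :
    algebraMap (MvPowerSeries (Fin 2) (ZMod 2)) Laurent f ∈ Rab := by
  obtain ⟨n, A, B, hA, hB, hAB⟩ := exists_eq_sum_of_mem_mixedAlgebra hpf
  refine ⟨n, A, B, p, hA, hB, hp, ?_⟩
  rw [← hAB, map_mul, mul_div_cancel_left₀]
  simpa [FaithfulSMul.algebraMap_eq_zero_iff] using hp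

theorem dual_languageOf (G : ContextFreeGrammar T) (a b : T) (A : G.NT) :
    dual a b (languageOf G A) = biSeries (ZMod 2) G a b [Symbol.nonterminal A] := by
  classical
  ext e
  have hmem : List.replicate (e 0) a ++ List.replicate (e 1) b ∈ languageOf G A ↔
      Odd (Nat.card (OfYield G [Symbol.nonterminal A]
        (List.replicate (e 0) a ++ List.replicate (e 1) b))) :=
    Iff.rfl
  rw [coeff_biSeries, count, MvPowerSeries.coeff_apply, dual, if_congr hmem rfl rfl]
  split_ifs with h
  · exact (ZMod.natCast_eq_one_iff_odd.2 h).symm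
  · exact (ZMod.natCast_eq_zero_iff_even.2 (Nat.not_odd_iff_even.1 h)).symm

end GF2

theorem theorem3p1_general {T : Type*} (a b : T) (K : Language T) (hG : GF2.IsDescribed K) :
    algebraMap (MvPowerSeries (Fin 2) (ZMod 2)) GF2.Laurent (GF2.dual a b K) ∈ GF2.Rab := by
  obtain ⟨G, hfin, rfl⟩ := hG
  rw [GF2.dual_languageOf]
  by_cases hG : Nonempty (GF2.ParseForest G [Symbol.nonterminal G.initial])
  · have htame : GF2.Tame G [Symbol.nonterminal G.initial] := ⟨hG, hfin⟩
    obtain ⟨p, hp, hmem⟩ :=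
      GF2.exists_coe_mul_biSeries_mem_mixedAlgebra (ZMod 2) a b ⟨G.initial, htame⟩
    exact GF2.algebraMap_mem_Rab hp hmem
  · have hzero : GF2.biSeries (ZMod 2) G a b [Symbol.nonterminal G.initial] = 0 := by
      ext e
      by_contra hne
      exact hG ((GF2.nonempty_of_count_ne_zero hne).map Subtype.val)
    rw [hzero]
    exact GF2.algebraMap_mem_Rab one_ne_zero (by simp)

theorem theorem3p1 {T : Type*} (a b : T) (hab : a ≠ b) (K : Language T)
    (hK : K ≤ GF2.aStarBStar a b) (hG : GF2.IsDescribed K) :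
    algebraMap (MvPowerSeries (Fin 2) (ZMod 2)) GF2.Laurent (GF2.dual a b K) ∈ GF2.Rab :=
  theorem3p1_general a b K hG
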